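/- All graphs are finite and simple. The class of cographs is the smallest isomorphism-closed class of graphs that contains $K_1$ and is closed under disjoint union and under join, where the join $G_1+G_2$ of two vertex-disjoint graphs is obtained from their disjoint union by adding all edges $uv$ with $u\in V(G_1)$, $v\in V(G_2)$. Let $\delta(G)$ be the minimum degree of $G$, and let the edge-connectivity $\lambda(G)$ be the minimum number of edges whose removal from $G$ results in a disconnected graph or in a graph with only one vertex (so $\lambda(K_1)=0$). The graph $G$ is maximally edge-connected if $\lambda(G)=\delta(G)$. An edge-cut of a connected graph $G$ is a set $F\subseteq E(G)$ such that $G-F$ is disconnected, and a connected graph $G$ is super edge-connected if for every edge-cut $F$ of $G$ with $|F|=\lambda(G)$ there is a vertex $v$ of degree $\delta(G)$ such that $F$ is the set of all edges incident with $v$. **Theorem.** Every connected cograph is maximally edge-connected. Moreover, a connected cograph $G$ is super edge-connected if and only if the following two conditions hold: 1. $G\not\cong C_4$; 2. $G$ is not isomorphic to a graph of the form $H+K_1$, where $H$ is a disconnected cograph of order at least $4$ with $\delta(H)\ge 1$ that has a connected component isomorphic to the complete graph $K_{\delta(G)}$. -/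

import Mathlib

universe u

namespace SimpleGraph

/-- The join of two (vertex-disjoint) graphs: their disjoint union together with all edges
between the two vertex sets. -/
def joinGraph {V W : Type*} (G : SimpleGraph V) (H : SimpleGraph W) : SimpleGraph (V ⊕ W) :=
  (G ⊕g H) ⊔ completeBipartiteGraph V W

/-- Cographs: the smallest isomorphism-closed class of graphs that contains `K₁` and is closed
under disjoint unions and joins. -/
inductive IsCograph : {V : Type u} → SimpleGraph V → Prop
  | single : IsCograph (⊥ : SimpleGraph PUnit.{u + 1})
  | union {V W : Type u} {G : SimpleGraph V} {H : SimpleGraph W} :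
      IsCograph G → IsCograph H → IsCograph (G ⊕g H)
  | join {V W : Type u} {G : SimpleGraph V} {H : SimpleGraph W} :
      IsCograph G → IsCograph H → IsCograph (joinGraph G H)
  | iso {V W : Type u} {G : SimpleGraph V} {H : SimpleGraph W} :
      (G ≃g H) → IsCograph G → IsCograph H

/-- An edge-cut: a set of edges of `G` whose removal leaves a disconnected graph. -/
def IsEdgeCut {V : Type u} (G : SimpleGraph V) (F : Finset (Sym2 V)) : Prop :=
  (F : Set (Sym2 V)) ⊆ G.edgeSet ∧ ¬ (G.deleteEdges (F : Set (Sym2 V))).Connected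

/-- The edge-connectivity of a finite graph: the minimum number of edges whose removal results in a
disconnected graph or a trivial (one-vertex) graph. -/
noncomputable def edgeConnectivity {V : Type u} (G : SimpleGraph V) : ℕ :=
  sInf {k : ℕ | ∃ F : Finset (Sym2 V), (F : Set (Sym2 V)) ⊆ G.edgeSet ∧ F.card = k ∧
    (¬ (G.deleteEdges (F : Set (Sym2 V))).Connected ∨ Nat.card V = 1)}

/-- `G` is maximally edge-connected if its edge-connectivity equals its minimum degree. -/
def IsMaximallyEdgeConnected {V : Type u} [Fintype V] (G : SimpleGraph V) [DecidableRel G.Adj] :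
    Prop :=
  G.edgeConnectivity = G.minDegree

/-- A connected graph `G` is super edge-connected if every edge-cut of size `λ(G)` consists of
all the edges at some vertex of degree `δ(G)`. -/
def IsSuperEdgeConnected {V : Type u} [Fintype V] (G : SimpleGraph V) [DecidableRel G.Adj] :
    Prop :=
  G.Connected ∧ ∀ F : Finset (Sym2 V), G.IsEdgeCut F → F.card = G.edgeConnectivity →
    ∃ v : V, G.degree v = G.minDegree ∧ (F : Set (Sym2 V)) = {e | ∃ w, G.Adj v w ∧ e = s(v, w)}

end SimpleGraph

/-! A connected cograph on at least two vertices is a join, so distinct nonadjacent vertices have a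
common neighbour. Hence for any vertex set `S`, one of `S` and `Sᶜ` has all its vertices incident
with the cut (`HasDiamLeTwo.isOuterDominated_or`). If `S` is that side and `v ∈ S`, then `v` has at
most `|S| - 1` neighbours in `S`, while the other `|S| - 1` vertices each send an edge out; so the
cut has at least `deg v ≥ δ` edges, and `λ = δ`.

If such a cut has `δ` edges and `|S| ≥ 2`, the count is tight: `S` is a clique of order `δ` with
exactly one outgoing edge per vertex. With at least two vertices outside `S`, the join structure
leaves two cases. If `S` meets both factors, then `G` is `C₄`; if `S` lies in one factor, the other
factor is a single vertex and `S` is a complete component of the first. Conversely, both exceptional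
graphs have a cut of size `δ` with two vertices on each side, which is never a star. -/

namespace SimpleGraph

/-! ### Edge cuts in graphs of diameter at most two. -/

section Cuts

variable {V : Type u} [Fintype V] (G : SimpleGraph V)

open Classical in
/-- The edges of `G` with exactly one end in `S`. -/
noncomputable def cutEdges (S : Finset V) : Finset (Sym2 V) :=
  ((S ×ˢ Sᶜ).filter fun p => G.Adj p.1 p.2).image fun p => s(p.1, p.2)

open Classical in
/-- The neighbours of `v` outside `S`. -/
noncomputable def outerNeighbors (S : Finset V) (v : V) : Finset V :=
  Finset.univ.filter fun w => w ∉ S ∧ G.Adj v w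

/-- Every vertex of `S` has a neighbour outside `S`. -/
def IsOuterDominated (S : Finset V) : Prop :=
  ∀ v ∈ S, ∃ w, w ∉ S ∧ G.Adj v w

/-- Distinct nonadjacent vertices have a common neighbour. -/
def HasDiamLeTwo {V : Type u} (G : SimpleGraph V) : Prop :=
  ∀ v w, v ≠ w → ¬ G.Adj v w → ∃ x, G.Adj v x ∧ G.Adj x w

variable {G}

theorem mem_cutEdges {S : Finset V} {e : Sym2 V} :
    e ∈ G.cutEdges S ↔ ∃ v w, v ∈ S ∧ w ∉ S ∧ G.Adj v w ∧ e = s(v, w) := by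
  simp only [cutEdges, Finset.mem_image, Finset.mem_filter, Finset.mem_product,
    Finset.mem_compl, Prod.exists]
  constructor
  · rintro ⟨a, b, ⟨⟨ha, hb⟩, hab⟩, rfl⟩
    exact ⟨a, b, ha, hb, hab, rfl⟩
  · rintro ⟨a, b, ha, hb, hab, rfl⟩
    exact ⟨a, b, ⟨⟨ha, hb⟩, hab⟩, rfl⟩

theorem mk_mem_cutEdges {S : Finset V} {v w : V} (hv : v ∈ S) (hw : w ∉ S) (h : G.Adj v w) :
    s(v, w) ∈ G.cutEdges S :=
  mem_cutEdges.2 ⟨v, w, hv, hw, h, rfl⟩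

theorem cutEdges_subset_edgeSet (S : Finset V) : (G.cutEdges S : Set (Sym2 V)) ⊆ G.edgeSet := by
  intro e he
  obtain ⟨v, w, -, -, h, rfl⟩ := mem_cutEdges.1 he
  exact h

theorem cutEdges_compl [DecidableEq V] (S : Finset V) : G.cutEdges Sᶜ = G.cutEdges S := by
  ext e
  simp only [mem_cutEdges, Finset.mem_compl, not_not]
  constructor <;> rintro ⟨v, w, hv, hw, h, rfl⟩ <;> exact ⟨w, v, hw, hv, h.symm, Sym2.eq_swap⟩

theorem mem_outerNeighbors {S : Finset V} {v w : V} :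
    w ∈ G.outerNeighbors S v ↔ w ∉ S ∧ G.Adj v w := by
  simp [outerNeighbors]

theorem card_cutEdges (S : Finset V) :
    (G.cutEdges S).card = ∑ v ∈ S, (G.outerNeighbors S v).card := by
  classical
  rw [cutEdges, Finset.card_image_of_injOn]
  · rw [← Finset.card_sigma]
    refine Finset.card_bij (fun p _ => ⟨p.1, p.2⟩) ?_ ?_ ?_
    · rintro ⟨a, b⟩ h
      simp only [Finset.mem_filter, Finset.mem_product, Finset.mem_compl] at h
      exact Finset.mem_sigma.2 ⟨h.1.1, mem_outerNeighbors.2 ⟨h.1.2, h.2⟩⟩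
    · rintro ⟨a, b⟩ _ ⟨c, d⟩ _ h
      simpa using h
    · rintro ⟨a, b⟩ h
      obtain ⟨h1, h2⟩ := Finset.mem_sigma.1 h
      obtain ⟨h3, h4⟩ := mem_outerNeighbors.1 h2
      exact ⟨(a, b), by simp_all, rfl⟩
  · rintro ⟨a, b⟩ h ⟨c, d⟩ h' e
    simp only [Finset.coe_filter, Finset.mem_product, Finset.mem_compl, Set.mem_ofPred_eq] at h h'
    rcases Sym2.eq_iff.1 e with ⟨h1, h2⟩ | ⟨h1, h2⟩
    · exact Prod.ext h1 h2
    · exact absurd (show c ∈ S from h'.1.1) (by rw [show c = b from h2.symm]; exact h.1.2)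

/-- A vertex failing on each side would give a nonadjacent pair with no common neighbour. -/
theorem HasDiamLeTwo.isOuterDominated_or [DecidableEq V] (hd : G.HasDiamLeTwo) (S : Finset V) :
    G.IsOuterDominated S ∨ G.IsOuterDominated Sᶜ := by
  by_contra! h
  simp only [IsOuterDominated, Finset.mem_compl, not_forall, not_exists, not_and, not_not] at h
  obtain ⟨⟨v, hv, hv'⟩, w, hw, hw'⟩ := h
  by_cases hvw : G.Adj v w
  · exact hv' w hw hvw
  · obtain ⟨x, hx, hx'⟩ := hd v w (fun e => hw (e ▸ hv)) hvw
    by_cases hxS : x ∈ S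
    · exact hw' x hxS hx'.symm
    · exact hv' x hxS hx

theorem degree_eq_inner_add_outer [DecidableEq V] [DecidableRel G.Adj] (S : Finset V) (v : V) :
    G.degree v = ((G.neighborFinset v).filter (· ∈ S)).card + (G.outerNeighbors S v).card := by
  rw [← card_neighborFinset_eq_degree,
    ← Finset.card_filter_add_card_filter_not (s := G.neighborFinset v) (· ∈ S)]
  congr 2
  ext w
  simp [mem_outerNeighbors, and_comm]

theorem IsOuterDominated.card_erase_le [DecidableEq V] {S : Finset V} (hS : G.IsOuterDominated S)
    (v : V) : (S.erase v).card ≤ ∑ w ∈ S.erase v, (G.outerNeighbors S w).card := by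
  rw [Finset.card_eq_sum_ones]
  refine Finset.sum_le_sum fun w hw => Finset.card_pos.2 ?_
  obtain ⟨x, hx⟩ := hS w (Finset.mem_of_mem_erase hw)
  exact ⟨x, mem_outerNeighbors.2 hx⟩

theorem inner_subset_erase [DecidableEq V] [DecidableRel G.Adj] (S : Finset V) (v : V) :
    (G.neighborFinset v).filter (· ∈ S) ⊆ S.erase v := by
  intro w hw
  simp only [Finset.mem_filter, mem_neighborFinset] at hw
  exact Finset.mem_erase.2 ⟨hw.1.ne', hw.2⟩

theorem IsOuterDominated.minDegree_le [DecidableRel G.Adj] {S : Finset V}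
    (hS : G.IsOuterDominated S) (hne : S.Nonempty) : G.minDegree ≤ (G.cutEdges S).card := by
  classical
  obtain ⟨v, hv⟩ := hne
  have h1 := G.minDegree_le_degree v
  have h2 := Finset.card_le_card (G.inner_subset_erase S v)
  have h3 := hS.card_erase_le v
  have h4 := Finset.add_sum_erase S (fun w => (G.outerNeighbors S w).card) hv
  rw [degree_eq_inner_add_outer S] at h1
  rw [card_cutEdges]
  omega

/-- A non-neighbour of `v` inside `S` would make the degree count at `v` strict. -/
theorem IsOuterDominated.isClique [DecidableRel G.Adj] {S : Finset V}
    (hS : G.IsOuterDominated S) (hcard : (G.cutEdges S).card ≤ G.minDegree) :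
    G.IsClique (S : Set V) := by
  classical
  intro v hv u hu hvu
  by_contra hadj
  have h1 := G.minDegree_le_degree v
  have h2 : ((G.neighborFinset v).filter (· ∈ S)).card < (S.erase v).card := by
    refine Finset.card_lt_card ⟨G.inner_subset_erase S v, fun h => hadj ?_⟩
    have := h (Finset.mem_erase.2 ⟨hvu.symm, hu⟩)
    simpa using (Finset.mem_filter.1 this).1
  have h3 := hS.card_erase_le v
  have h4 := Finset.add_sum_erase S (fun w => (G.outerNeighbors S w).card) hv
  rw [degree_eq_inner_add_outer S] at h1
  rw [card_cutEdges] at hcard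
  omega

/-- The degree count is made at another vertex `v` of `S`, which leaves no slack for a second edge
out of `u`; this is where `2 ≤ S.card` enters. -/
theorem IsOuterDominated.card_outerNeighbors [DecidableRel G.Adj] {S : Finset V}
    (hS : G.IsOuterDominated S) (hcard : (G.cutEdges S).card ≤ G.minDegree) (hS2 : 2 ≤ S.card)
    {u : V} (hu : u ∈ S) : (G.outerNeighbors S u).card = 1 := by
  classical
  obtain ⟨v, hv, hvu⟩ := Finset.exists_mem_ne hS2 u
  have hu' : u ∈ S.erase v := Finset.mem_erase.2 ⟨hvu.symm, hu⟩
  have h1 := G.minDegree_le_degree v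
  have h2 := Finset.card_le_card (G.inner_subset_erase S v)
  have h3 : ((S.erase v).erase u).card ≤
      ∑ w ∈ (S.erase v).erase u, (G.outerNeighbors S w).card := by
    rw [Finset.card_eq_sum_ones]
    refine Finset.sum_le_sum fun w hw => Finset.card_pos.2 ?_
    obtain ⟨x, hx⟩ := hS w (Finset.mem_of_mem_erase (Finset.mem_of_mem_erase hw))
    exact ⟨x, mem_outerNeighbors.2 hx⟩
  have h4 := Finset.add_sum_erase S (fun w => (G.outerNeighbors S w).card) hv
  have h5 := Finset.add_sum_erase _ (fun w => (G.outerNeighbors S w).card) hu'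
  have h6 : 0 < (G.outerNeighbors S u).card := by
    obtain ⟨x, hx⟩ := hS u hu
    exact Finset.card_pos.2 ⟨x, mem_outerNeighbors.2 hx⟩
  have h7 := Finset.card_erase_add_one hu'
  rw [degree_eq_inner_add_outer S] at h1
  rw [card_cutEdges] at hcard
  omega

theorem exists_cutEdges_subset [Nonempty V] {F : Finset (Sym2 V)}
    (h : ¬ (G.deleteEdges (F : Set (Sym2 V))).Connected) :
    ∃ S : Finset V, S.Nonempty ∧ (∃ v, v ∉ S) ∧ G.cutEdges S ⊆ F := by
  classical
  have h' : ¬ (G.deleteEdges (F : Set (Sym2 V))).Preconnected := fun hp => h ⟨hp⟩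
  simp only [Preconnected, not_forall] at h'
  obtain ⟨a, b, hab⟩ := h'
  -- `S` is the component of `a` after deletion, so every edge leaving it lies in `F`.
  refine ⟨Finset.univ.filter fun x => (G.deleteEdges (F : Set (Sym2 V))).Reachable a x,
    ⟨a, by simp⟩, ⟨b, by simpa using hab⟩, fun e he => ?_⟩
  obtain ⟨v, w, hv, hw, hvw, rfl⟩ := mem_cutEdges.1 he
  simp only [Finset.mem_filter, Finset.mem_univ, true_and] at hv hw
  by_contra hF
  exact hw (hv.trans (Adj.reachable (by simpa [deleteEdges_adj] using ⟨hvw, hF⟩)))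

theorem isEdgeCut_cutEdges {S : Finset V} {v w : V} (hv : v ∈ S) (hw : w ∉ S) :
    G.IsEdgeCut (G.cutEdges S) := by
  refine ⟨cutEdges_subset_edgeSet S, fun h => ?_⟩
  obtain ⟨p⟩ := h.preconnected v w
  obtain ⟨d, -, h1, h2⟩ := p.exists_boundary_dart (S : Set V) hv hw
  have h3 := d.adj
  rw [deleteEdges_adj] at h3
  exact h3.2 (mk_mem_cutEdges h1 h2 h3.1)

theorem HasDiamLeTwo.minDegree_le_card [DecidableRel G.Adj] (hd : G.HasDiamLeTwo) {S : Finset V}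
    {v w : V} (hv : v ∈ S) (hw : w ∉ S) : G.minDegree ≤ (G.cutEdges S).card := by
  classical
  rcases hd.isOuterDominated_or S with h | h
  · exact h.minDegree_le ⟨v, hv⟩
  · rw [← cutEdges_compl]
    exact h.minDegree_le ⟨w, Finset.mem_compl.2 hw⟩

theorem coe_cutEdges_singleton (v : V) :
    (G.cutEdges {v} : Set (Sym2 V)) = {e | ∃ w, G.Adj v w ∧ e = s(v, w)} := by
  ext e
  simp only [Finset.mem_coe, mem_cutEdges, Finset.mem_singleton, Set.mem_ofPred_eq]
  constructor
  · rintro ⟨_, w, rfl, -, h, rfl⟩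
    exact ⟨w, h, rfl⟩
  · rintro ⟨w, h, rfl⟩
    exact ⟨v, w, rfl, h.ne', h, rfl⟩

theorem card_cutEdges_singleton [DecidableRel G.Adj] (v : V) :
    (G.cutEdges {v}).card = G.degree v := by
  rw [card_cutEdges, Finset.sum_singleton, ← card_neighborFinset_eq_degree]
  congr 1
  ext w
  simp only [mem_outerNeighbors, Finset.mem_singleton, mem_neighborFinset]
  exact ⟨fun h => h.2, fun h => ⟨h.ne', h⟩⟩

theorem HasDiamLeTwo.edgeConnectivity_eq [Nonempty V] [DecidableRel G.Adj]
    (hd : G.HasDiamLeTwo) : G.edgeConnectivity = G.minDegree := by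
  classical
  obtain ⟨v, hv⟩ := G.exists_minimal_degree_vertex
  have hmem : G.minDegree ∈ {k : ℕ | ∃ F : Finset (Sym2 V), (F : Set (Sym2 V)) ⊆ G.edgeSet ∧
      F.card = k ∧ (¬ (G.deleteEdges (F : Set (Sym2 V))).Connected ∨ Nat.card V = 1)} := by
    refine ⟨G.cutEdges {v}, cutEdges_subset_edgeSet _, ?_, ?_⟩
    · rw [card_cutEdges_singleton, hv]
    · by_cases h : ∃ w, w ≠ v
      · obtain ⟨w, hw⟩ := h
        exact Or.inl (isEdgeCut_cutEdges (v := v) (w := w) (by simp) (by simpa using hw)).2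
      · push Not at h
        exact Or.inr (Nat.card_eq_one_iff_unique.2
          ⟨⟨fun a b => (h a).trans (h b).symm⟩, ⟨v⟩⟩)
  refine le_antisymm (Nat.sInf_le hmem) (le_csInf ⟨_, hmem⟩ ?_)
  rintro k ⟨F, -, rfl, h | h⟩
  · obtain ⟨S, ⟨a, ha⟩, ⟨b, hb⟩, hSF⟩ := exists_cutEdges_subset h
    exact (hd.minDegree_le_card ha hb).trans (Finset.card_le_card hSF)
  -- On one vertex the minimum degree is 0.
  · rw [Nat.card_eq_fintype_card] at h
    have := G.degree_lt_card_verts v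
    omega

/-- If the cut were the star of `v`, another vertex `u` on the side of `v` would be nonadjacent to
`v`; a common neighbour `x` then lies across, and `ux` is a cut edge missing `v`. -/
theorem HasDiamLeTwo.not_isSuperEdgeConnected [DecidableRel G.Adj] (hd : G.HasDiamLeTwo)
    {S : Finset V} (h1 : ∃ a ∈ S, ∃ b ∈ S, a ≠ b) (h2 : ∃ a, a ∉ S ∧ ∃ b, b ∉ S ∧ a ≠ b)
    (hcard : (G.cutEdges S).card ≤ G.minDegree) : ¬ G.IsSuperEdgeConnected := by
  classical
  rintro ⟨-, hs⟩
  obtain ⟨a, ha, b, hb, hab⟩ := h1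
  obtain ⟨c, hc, d, hd', hcd⟩ := h2
  have : Nonempty V := ⟨a⟩
  obtain ⟨v, -, hv⟩ := hs _ (isEdgeCut_cutEdges ha hc)
    (by rw [hd.edgeConnectivity_eq]; exact le_antisymm hcard (hd.minDegree_le_card ha hc))
  have key : ∀ (T : Finset V), G.cutEdges T = G.cutEdges S → v ∈ T →
      ∀ u, u ∈ T → u ≠ v → False := by
    intro T hT hvT u huT huv
    rw [← hT] at hv
    have out : ∀ w, G.Adj v w → w ∉ T := by
      intro w hw
      have : s(v, w) ∈ (G.cutEdges T : Set (Sym2 V)) := by rw [hv]; exact ⟨w, hw, rfl⟩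
      obtain ⟨x, y, hx, hy, -, e⟩ := mem_cutEdges.1 this
      rcases Sym2.eq_iff.1 e with ⟨rfl, rfl⟩ | ⟨rfl, rfl⟩
      · exact hy
      · exact absurd hvT hy
    obtain ⟨x, hvx, hxu⟩ := hd v u huv.symm (fun h => out u h huT)
    have : s(u, x) ∈ (G.cutEdges T : Set (Sym2 V)) := mk_mem_cutEdges huT (out x hvx) hxu.symm
    rw [hv] at this
    obtain ⟨w, -, e⟩ := this
    rcases Sym2.eq_iff.1 e with ⟨h, -⟩ | ⟨-, h⟩
    · exact huv h
    · exact hvx.ne h.symm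
  by_cases hvS : v ∈ S
  · by_cases hav : a = v
    · exact key S rfl hvS b hb (fun h => hab (hav.trans h.symm))
    · exact key S rfl hvS a ha hav
  · have hvS' := Finset.mem_compl.2 hvS
    by_cases hcv : c = v
    · exact key Sᶜ (cutEdges_compl S) hvS' d (Finset.mem_compl.2 hd')
        (fun h => hcd (hcv.trans h.symm))
    · exact key Sᶜ (cutEdges_compl S) hvS' c (Finset.mem_compl.2 hc) hcv

end Cuts

/-! ### Joins and the structure of connected cographs. -/

section Join

theorem joinGraph_adj_inl {A B : Type*} {G : SimpleGraph A} {H : SimpleGraph B} {a b : A} :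
    (joinGraph G H).Adj (Sum.inl a) (Sum.inl b) ↔ G.Adj a b := by
  simp [joinGraph]

theorem joinGraph_adj_inl_inr {A B : Type*} {G : SimpleGraph A} {H : SimpleGraph B} (a : A)
    (b : B) : (joinGraph G H).Adj (Sum.inl a) (Sum.inr b) := by
  simp [joinGraph]

/-- The join is commutative up to isomorphism. -/
def joinGraphComm {A B : Type*} (G : SimpleGraph A) (H : SimpleGraph B) :
    joinGraph G H ≃g joinGraph H G where
  toEquiv := Equiv.sumComm A B
  map_rel_iff' := by
    rintro (a | a) (b | b) <;> simp [joinGraph]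

/-- Isomorphic right factors give isomorphic joins. -/
def joinGraphCongrRight {A B C : Type*} (G : SimpleGraph A) {H : SimpleGraph B}
    {K : SimpleGraph C} (e : H ≃g K) : joinGraph G H ≃g joinGraph G K where
  toEquiv := Equiv.sumCongr (Equiv.refl A) e.toEquiv
  map_rel_iff' := by
    rintro (a | a) (b | b) <;> simp [joinGraph]
    exact e.map_rel_iff'

theorem IsCograph.nonempty {V : Type u} {G : SimpleGraph V} (h : G.IsCograph) : Nonempty V := by
  induction h with
  | single => exact ⟨PUnit.unit⟩
  | union _ _ ih _ => exact ih.map Sum.inl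
  | join _ _ ih _ => exact ih.map Sum.inl
  | iso e _ ih => exact ih.map e

theorem IsCograph.subsingleton_or_join {V : Type u} {G : SimpleGraph V} (h : G.IsCograph)
    (hc : G.Connected) : Subsingleton V ∨ ∃ (A B : Type u) (H : SimpleGraph A)
      (K : SimpleGraph B), H.IsCograph ∧ K.IsCograph ∧ Nonempty (G ≃g joinGraph H K) := by
  induction h with
  | single => exact Or.inl inferInstance
  | union hG hH =>
    have := hG.nonempty
    have := hH.nonempty
    exact absurd hc not_connected_sum
  | join hG hH => exact Or.inr ⟨_, _, _, _, hG, hH, ⟨Iso.refl⟩⟩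
  | iso e _ ih =>
    rcases ih (e.connected_iff.2 hc) with h | ⟨A, B, H, K, hH, hK, ⟨f⟩⟩
    · exact Or.inl (e.symm.toEquiv.subsingleton)
    · exact Or.inr ⟨A, B, H, K, hH, hK, ⟨e.symm.trans f⟩⟩

theorem HasDiamLeTwo.of_join {V A B : Type u} [Nonempty A] [Nonempty B] {G : SimpleGraph V}
    {H : SimpleGraph A} {K : SimpleGraph B} (f : G ≃g joinGraph H K) : G.HasDiamLeTwo := by
  intro v w _ hadj
  obtain ⟨a⟩ := ‹Nonempty A›
  obtain ⟨b⟩ := ‹Nonempty B›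
  have hcross : ∀ a b, G.Adj (f.symm (Sum.inl a)) (f.symm (Sum.inr b)) := fun a b =>
    f.symm.map_adj_iff.2 (joinGraph_adj_inl_inr a b)
  obtain ⟨x, rfl⟩ := f.symm.surjective v
  obtain ⟨y, rfl⟩ := f.symm.surjective w
  rcases x with x | x <;> rcases y with y | y
  · exact ⟨_, hcross x b, (hcross y b).symm⟩
  · exact absurd (hcross x y) hadj
  · exact absurd (hcross y x).symm hadj
  · exact ⟨_, (hcross a x).symm, hcross a y⟩

end Join

theorem nonempty_iso_cycleGraph_four {V : Type u} {G : SimpleGraph V} {x y z w : V}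
    (hall : ∀ v, v = x ∨ v = y ∨ v = z ∨ v = w)
    (hxy : G.Adj x y) (hyz : G.Adj y z) (hzw : G.Adj z w) (hwx : G.Adj w x)
    (hxz : ¬ G.Adj x z) (hyw : ¬ G.Adj y w) (hxz' : x ≠ z) (hyw' : y ≠ w) :
    Nonempty (G ≃g cycleGraph 4) := by
  have hxz2 : ¬ G.Adj z x := fun h => hxz h.symm
  have hyw2 : ¬ G.Adj w y := fun h => hyw h.symm
  let f : Fin 4 → V := ![x, y, z, w]
  have hf : Function.Bijective f := by
    constructor
    · intro i j h
      fin_cases i <;> fin_cases j <;>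
        first
        | rfl
        | (exfalso; simp [f] at h; subst h; simp_all)
    · intro v
      rcases hall v with rfl | rfl | rfl | rfl
      exacts [⟨0, rfl⟩, ⟨1, rfl⟩, ⟨2, rfl⟩, ⟨3, rfl⟩]
  refine ⟨Iso.symm ⟨Equiv.ofBijective f hf, ?_⟩⟩
  intro i j
  have hc : ∀ i j : Fin 4, (cycleGraph 4).Adj i j ↔ (i + 1 = j ∨ j + 1 = i) := by decide
  rw [hc]
  fin_cases i <;> fin_cases j <;>
    simp [f, hxy, hyz, hzw, hwx, hxz, hyw, hxz2, hyw2, hxy.symm, hyz.symm, hzw.symm, hwx.symm]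

/-! ### Minimum cuts that are not stars. -/

section Structure

variable {V : Type u} [Fintype V] {G : SimpleGraph V} [DecidableRel G.Adj]

theorem IsOuterDominated.eq_of_adj {S : Finset V}
    (hS : G.IsOuterDominated S) (hcard : (G.cutEdges S).card ≤ G.minDegree) (hS2 : 2 ≤ S.card)
    {u v w : V} (hu : u ∈ S) (hv : v ∉ S) (hw : w ∉ S) (huv : G.Adj u v) (huw : G.Adj u w) :
    v = w :=
  Finset.card_le_one.1 (hS.card_outerNeighbors hcard hS2 hu).le v
    (mem_outerNeighbors.2 ⟨hv, huv⟩) w (mem_outerNeighbors.2 ⟨hw, huw⟩)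

theorem IsOuterDominated.card_eq {S : Finset V}
    (hS : G.IsOuterDominated S) (hcard : (G.cutEdges S).card ≤ G.minDegree) (hS2 : 2 ≤ S.card) :
    S.card = G.minDegree := by
  refine le_antisymm ?_ ?_
  · refine le_trans ?_ hcard
    rw [card_cutEdges, Finset.sum_congr rfl fun u hu => hS.card_outerNeighbors hcard hS2 hu]
    simp
  · refine (hS.minDegree_le (Finset.card_pos.1 (by omega))).trans ?_
    rw [card_cutEdges, Finset.sum_congr rfl fun u hu => hS.card_outerNeighbors hcard hS2 hu]
    simp

theorem IsOuterDominated.iso_cycleGraph_four {A B : Type u} {H : SimpleGraph A}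
    {K : SimpleGraph B} (f : G ≃g joinGraph H K) {S : Finset V} (hS : G.IsOuterDominated S)
    (hcard : (G.cutEdges S).card ≤ G.minDegree) (hS2 : 2 ≤ S.card)
    {x y z w : V} (hx : x ∈ S) (hy : y ∈ S) (hz : z ∉ S) (hw : w ∉ S) (hzw : z ≠ w)
    (hfx : (f x).isLeft) (hfy : ¬ (f y).isLeft) : Nonempty (G ≃g cycleGraph 4) := by
  classical
  have hadj : ∀ u v, (f u).isLeft → ¬ (f v).isLeft → G.Adj u v := by
    intro u v hu hv
    rw [← f.map_adj_iff]
    rcases hu' : f u with a | a <;> rcases hv' : f v with b | b <;> simp_all [joinGraph]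
  have hcl := hS.isClique hcard
  have uniq := fun {u v w : V} => hS.eq_of_adj hcard hS2 (u := u) (v := v) (w := w)
  -- Outer vertices in the same factor would both be neighbours of a vertex of `S` in the other
  -- factor, so `z` and `w` lie in different factors.
  wlog hfz : (f z).isLeft generalizing z w with key
  · by_cases hfw : (f w).isLeft
    · exact key hw hz hzw.symm hfw
    · exact absurd (uniq hx hz hw (hadj _ _ hfx hfz) (hadj _ _ hfx hfw)) hzw
  have hfw : ¬ (f w).isLeft := fun hfw =>
    hzw (uniq hy hz hw (hadj _ _ hfz hfy).symm (hadj _ _ hfw hfy).symm)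
  have hout : ∀ v, v ∉ S → v = z ∨ v = w := by
    intro v hv
    by_cases hfv : (f v).isLeft
    · exact Or.inl (uniq hy hv hz (hadj _ _ hfv hfy).symm (hadj _ _ hfz hfy).symm)
    · exact Or.inr (uniq hx hv hw (hadj _ _ hfx hfv) (hadj _ _ hfx hfw))
  have hSc := hS.card_eq hcard hS2
  have hsplit := Finset.card_filter_add_card_filter_not (s := S) (fun v => (f v).isLeft = true)
  -- A left vertex of `S` already sees `w`, so it misses `z`. Thus `deg z` is at most one plus the
  -- number of right vertices of `S`, while `δ = |S|`.
  have hL : (S.filter fun v => (f v).isLeft = true).card ≤ 1 := by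
    have h1 := G.minDegree_le_degree z
    have h2 : G.neighborFinset z ⊆ insert w (S.filter fun v => ¬ (f v).isLeft = true) := by
      intro v hv
      rw [mem_neighborFinset] at hv
      by_cases hvS : v ∈ S
      · refine Finset.mem_insert_of_mem (Finset.mem_filter.2 ⟨hvS, fun hfv => hzw ?_⟩)
        exact uniq hvS hz hw hv.symm (hadj _ _ hfv hfw)
      · rcases hout v hvS with rfl | rfl
        · exact absurd rfl hv.ne
        · exact Finset.mem_insert_self _ _
    have h3 := (Finset.card_le_card h2).trans (Finset.card_insert_le _ _)
    rw [card_neighborFinset_eq_degree] at h3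
    omega
  have hR : (S.filter fun v => ¬ (f v).isLeft = true).card ≤ 1 := by
    have h1 := G.minDegree_le_degree w
    have h2 : G.neighborFinset w ⊆ insert z (S.filter fun v => (f v).isLeft = true) := by
      intro v hv
      rw [mem_neighborFinset] at hv
      by_cases hvS : v ∈ S
      · refine Finset.mem_insert_of_mem (Finset.mem_filter.2 ⟨hvS, ?_⟩)
        by_contra hfv
        exact hzw (uniq hvS hz hw (hadj _ _ hfz hfv).symm hv.symm)
      · rcases hout v hvS with rfl | rfl
        · exact Finset.mem_insert_self _ _
        · exact absurd rfl hv.ne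
    have h3 := (Finset.card_le_card h2).trans (Finset.card_insert_le _ _)
    rw [card_neighborFinset_eq_degree] at h3
    omega
  refine nonempty_iso_cycleGraph_four (x := x) (y := y) (z := z) (w := w) ?_
    (hadj _ _ hfx hfy) (hadj _ _ hfz hfy).symm (hadj _ _ hfz hfw) (hadj _ _ hfx hfw).symm
    (fun h => hzw (uniq hx hz hw h (hadj _ _ hfx hfw)))
    (fun h => hzw (uniq hy hz hw (hadj _ _ hfz hfy).symm h)) (fun h => hz (h ▸ hx))
    (fun h => hw (h ▸ hy))
  intro v
  by_cases hvS : v ∈ S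
  · by_cases hfv : (f v).isLeft
    · exact Or.inl (Finset.card_le_one.1 hL v (by simp [hvS, hfv]) x (by simp [hx, hfx]))
    · exact Or.inr (Or.inl (Finset.card_le_one.1 hR v (Finset.mem_filter.2 ⟨hvS, hfv⟩) y
        (Finset.mem_filter.2 ⟨hy, hfy⟩)))
  · exact Or.inr (Or.inr (hout v hvS))

/-- `G` is the join of `K₁` and a disconnected cograph of order at least `4` without isolated
vertices that has a component isomorphic to the complete graph of order `δ(G)`. -/
def IsExceptionalJoin (G : SimpleGraph V) [DecidableRel G.Adj] : Prop :=
  ∃ (W : Type u) (_ : Fintype W) (H : SimpleGraph W) (_ : DecidableRel H.Adj),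
    H.IsCograph ∧ ¬ H.Connected ∧ 4 ≤ Fintype.card W ∧ 1 ≤ H.minDegree ∧
    (∃ C : H.ConnectedComponent,
      Nonempty (C.toSimpleGraph ≃g (⊤ : SimpleGraph (Fin G.minDegree)))) ∧
    Nonempty (G ≃g joinGraph H (⊤ : SimpleGraph (Fin 1)))

/-- Two mutually unreachable vertices, each with a neighbour, give four distinct vertices; the order
condition is thus automatic. -/
theorem four_le_card_of_not_connected {W : Type*} [Fintype W] [Nonempty W] {H : SimpleGraph W}
    [DecidableRel H.Adj] (hc : ¬ H.Connected) (hd : 1 ≤ H.minDegree) : 4 ≤ Fintype.card W := by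
  classical
  have h' : ¬ H.Preconnected := fun hp => hc ⟨hp⟩
  simp only [Preconnected, not_forall] at h'
  obtain ⟨a, b, hab⟩ := h'
  obtain ⟨a', ha⟩ := (H.degree_pos_iff_exists_adj a).1 (hd.trans (H.minDegree_le_degree a))
  obtain ⟨b', hb⟩ := (H.degree_pos_iff_exists_adj b).1 (hd.trans (H.minDegree_le_degree b))
  have h1 : a ≠ b := fun h => hab (h ▸ Reachable.rfl)
  have h2 : a ≠ b' := fun h => hab (h ▸ hb.symm.reachable)
  have h3 : a' ≠ b := fun h => hab (h ▸ ha.reachable)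
  have h4 : a' ≠ b' := fun h => hab (ha.reachable.trans (h ▸ hb.symm.reachable))
  have h5 : ({a, a', b, b'} : Finset W).card = 4 := by
    simp [Finset.card_insert_of_notMem, h1, h2, h3, h4, ha.ne, hb.ne]
  exact h5 ▸ Finset.card_le_univ _

theorem IsOuterDominated.isExceptionalJoin {A B : Type u} {H : SimpleGraph A}
    {K : SimpleGraph B} (hH : H.IsCograph) (hK : Nonempty B)
    (f : G ≃g joinGraph H K) {S : Finset V} (hS : G.IsOuterDominated S)
    (hcard : (G.cutEdges S).card ≤ G.minDegree) (hS2 : 2 ≤ S.card)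
    {z w : V} (hz : z ∉ S) (hw : w ∉ S) (hzw : z ≠ w) (hf : ∀ v ∈ S, (f v).isLeft) :
    G.IsExceptionalJoin := by
  classical
  have hcl := hS.isClique hcard
  have uniq := fun {u v w : V} => hS.eq_of_adj hcard hS2 (u := u) (v := v) (w := w)
  have hSc := hS.card_eq hcard hS2
  obtain ⟨s, hs⟩ : S.Nonempty := Finset.card_pos.1 (by omega)
  have hleft : ∀ v ∈ S, ∃ a, v = f.symm (Sum.inl a) := by
    intro v hv
    obtain ⟨a, ha⟩ := Sum.isLeft_iff.1 (hf v hv)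
    exact ⟨a, by rw [← ha]; simp⟩
  have hright : ∀ b, f.symm (Sum.inr b) ∉ S := fun b hb => by simpa using hf _ hb
  have hcross : ∀ a b, G.Adj (f.symm (Sum.inl a)) (f.symm (Sum.inr b)) := fun a b =>
    f.symm.map_adj_iff.2 (joinGraph_adj_inl_inr a b)
  have hadj : ∀ a b, G.Adj (f.symm (Sum.inl a)) (f.symm (Sum.inl b)) ↔ H.Adj a b := fun a b =>
    f.symm.map_adj_iff.trans joinGraph_adj_inl
  obtain ⟨t, rfl⟩ := hleft s hs
  -- All of `B` lies outside `S` and is adjacent to `t`, which has one outer neighbour.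
  have hB : Subsingleton B := ⟨fun b c => by
    simpa using uniq hs (hright b) (hright c) (hcross t b) (hcross t c)⟩
  obtain ⟨b₀⟩ := hK
  have e : V ≃ A ⊕ B := f.toEquiv
  have : Finite (A ⊕ B) := Finite.of_equiv V e
  have : Finite A := Finite.sum_left B
  have : Fintype A := Fintype.ofFinite A
  let g : G ≃g joinGraph H (⊤ : SimpleGraph (Fin 1)) := f.trans <| joinGraphCongrRight H
    { toEquiv := { toFun := fun _ => 0, invFun := fun _ => b₀,
                   left_inv := fun _ => Subsingleton.elim _ _,
                   right_inv := fun _ => Subsingleton.elim _ _ }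
      map_rel_iff' := by
        intro a b
        rw [Subsingleton.elim a b]
        simp }
  -- The only outer neighbour of a vertex of `S` is the one in `B`, so `S` is closed under
  -- `H`-adjacency.
  have hclosed : ∀ a b, f.symm (Sum.inl a) ∈ S → H.Adj a b → f.symm (Sum.inl b) ∈ S := by
    intro a b ha hab
    by_contra hb
    simpa using uniq ha hb (hright b₀) ((hadj a b).2 hab) (hcross a b₀)
  have hreach : ∀ a, H.Reachable t a ↔ f.symm (Sum.inl a) ∈ S := by
    intro a
    constructor
    · rintro ⟨p⟩
      by_contra ha
      obtain ⟨d, -, h1, h2⟩ := p.exists_boundary_dart {a | f.symm (Sum.inl a) ∈ S} hs ha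
      exact h2 (hclosed _ _ h1 d.adj)
    · intro ha
      by_cases hta : t = a
      · exact hta ▸ Reachable.rfl
      · exact ((hadj t a).1 (hcl hs ha (by simpa using hta))).reachable
  have hexists : ∃ a, f.symm (Sum.inl a) ∉ S := by
    have : ∃ v, v ∉ S ∧ v ≠ f.symm (Sum.inr b₀) := by
      by_cases h : z = f.symm (Sum.inr b₀)
      · exact ⟨w, hw, fun h' => hzw (h.trans h'.symm)⟩
      · exact ⟨z, hz, h⟩
    obtain ⟨v, hv, hne⟩ := this
    rcases hfv : f v with a | b
    · exact ⟨a, by rw [← hfv]; simpa using hv⟩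
    · exact absurd (by rw [Subsingleton.elim b₀ b, ← hfv]; simp) hne
  have hnc : ¬ H.Connected := fun h => by
    obtain ⟨a, ha⟩ := hexists
    exact ha ((hreach a).1 (h.preconnected t a))
  have hAne : Nonempty A := ⟨t⟩
  -- Since `δ = |S| ≥ 2`, each vertex of `A` has a neighbour besides `b₀`.
  have hdeg : 1 ≤ H.minDegree := by
    refine H.le_minDegree_of_forall_le_degree 1 fun a => ?_
    have h1 := G.minDegree_le_degree (f.symm (Sum.inl a))
    rw [← card_neighborFinset_eq_degree] at h1
    obtain ⟨v, hv, hne⟩ := Finset.exists_mem_ne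
      (show 1 < (G.neighborFinset (f.symm (Sum.inl a))).card by omega) (f.symm (Sum.inr b₀))
    rw [mem_neighborFinset] at hv
    refine (H.degree_pos_iff_exists_adj a).2 ?_
    rcases hfv : f v with c | b
    · exact ⟨c, (hadj a c).1 (by rw [← hfv]; simpa using hv)⟩
    · exact absurd (by rw [Subsingleton.elim b₀ b, ← hfv]; simp) hne
  refine ⟨A, inferInstance, H, inferInstance, hH, hnc, four_le_card_of_not_connected hnc hdeg,
    hdeg, ⟨H.connectedComponentMk t, ?_⟩, ⟨g⟩⟩
  have hmem : ∀ a, a ∈ (H.connectedComponentMk t).supp ↔ f.symm (Sum.inl a) ∈ S := by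
    intro a
    rw [ConnectedComponent.mem_supp_iff, ConnectedComponent.eq, reachable_comm, hreach]
  have hcardC : Nat.card (H.connectedComponentMk t).supp = G.minDegree := by
    rw [← hSc, ← Fintype.card_coe S, ← Nat.card_eq_fintype_card]
    refine Nat.card_congr (Equiv.ofBijective
      (fun a => ⟨f.symm (Sum.inl a.1), (hmem a.1).1 a.2⟩) ⟨?_, ?_⟩)
    · rintro ⟨a, ha⟩ ⟨b, hb⟩ h
      simpa using h
    · rintro ⟨v, hv⟩
      obtain ⟨a, rfl⟩ := hleft v hv
      exact ⟨⟨a, (hmem a).2 hv⟩, rfl⟩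
  let e : (H.connectedComponentMk t).supp ≃ Fin G.minDegree := Finite.equivFinOfCardEq hcardC
  refine ⟨⟨e, ?_⟩⟩
  rintro ⟨a, ha⟩ ⟨b, hb⟩
  rw [top_adj, ConnectedComponent.toSimpleGraph_adj]
  constructor
  · intro h
    refine (hadj a b).1 (hcl ((hmem a).1 ha) ((hmem b).1 hb) fun h' => h ?_)
    congr 2
    simpa using h'
  · intro h h'
    exact h.ne (congrArg Subtype.val (e.injective h'))

end Structure

theorem IsCograph.hasDiamLeTwo {V : Type u} {G : SimpleGraph V} (hG : G.IsCograph)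
    (hc : G.Connected) : G.HasDiamLeTwo := by
  rcases hG.subsingleton_or_join hc with h | ⟨A, B, H, K, hH, hK, ⟨f⟩⟩
  · exact fun _ _ h => absurd (Subsingleton.elim _ _) h
  · have := hH.nonempty
    have := hK.nonempty
    exact HasDiamLeTwo.of_join f

/-! ### The characterization of super edge-connectedness. -/

section Main

variable {V : Type u} [Fintype V] {G : SimpleGraph V} [DecidableRel G.Adj]

theorem IsOuterDominated.isExceptional (hG : G.IsCograph) (hc : G.Connected) {S : Finset V}
    (hS : G.IsOuterDominated S) (hcard : (G.cutEdges S).card ≤ G.minDegree) (hS2 : 2 ≤ S.card)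
    {z w : V} (hz : z ∉ S) (hw : w ∉ S) (hzw : z ≠ w) :
    Nonempty (G ≃g cycleGraph 4) ∨ G.IsExceptionalJoin := by
  rcases hG.subsingleton_or_join hc with h | ⟨A, B, H, K, hH, hK, ⟨f⟩⟩
  · exact absurd (Subsingleton.elim z w) hzw
  by_cases hl : ∀ v ∈ S, (f v).isLeft
  · exact Or.inr (hS.isExceptionalJoin hH hK.nonempty f hcard hS2 hz hw hzw hl)
  by_cases hr : ∀ v ∈ S, ¬ (f v).isLeft
  · refine Or.inr (hS.isExceptionalJoin hK hH.nonempty (f.trans (joinGraphComm H K)) hcard hS2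
      hz hw hzw fun v hv => ?_)
    have := hr v hv
    rcases hfv : f v with a | b <;> simp_all [joinGraphComm]
  push Not at hl hr
  obtain ⟨y, hy, hfy⟩ := hl
  obtain ⟨x, hx, hfx⟩ := hr
  exact Or.inl (hS.iso_cycleGraph_four f hcard hS2 hx hy hz hw hzw hfx hfy)

theorem IsCograph.isSuperEdgeConnected (hG : G.IsCograph) (hc : G.Connected)
    (h4 : ¬ Nonempty (G ≃g cycleGraph 4)) (hj : ¬ G.IsExceptionalJoin) :
    G.IsSuperEdgeConnected := by
  classical
  have := hc.nonempty
  have hd := hG.hasDiamLeTwo hc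
  refine ⟨hc, fun F hF hcard => ?_⟩
  rw [hd.edgeConnectivity_eq] at hcard
  obtain ⟨S, ⟨a, ha⟩, ⟨b, hb⟩, hSF⟩ := exists_cutEdges_subset hF.2
  -- The cut inside `F` already has at least `δ = |F|` edges.
  have hSF' : G.cutEdges S = F :=
    Finset.eq_of_subset_of_card_le hSF (hcard.le.trans (hd.minDegree_le_card ha hb))
  have key : ∀ T : Finset V, T.card = 1 → G.cutEdges T = F →
      ∃ v : V, G.degree v = G.minDegree ∧
        (F : Set (Sym2 V)) = {e | ∃ w, G.Adj v w ∧ e = s(v, w)} := by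
    intro T hT hTF
    obtain ⟨v, rfl⟩ := Finset.card_eq_one.1 hT
    exact ⟨v, by rw [← card_cutEdges_singleton, hTF, hcard],
      by rw [← hTF, coe_cutEdges_singleton]⟩
  by_cases hS1 : S.card = 1
  · exact key S hS1 hSF'
  by_cases hS2 : Sᶜ.card = 1
  · exact key Sᶜ hS2 (by rw [cutEdges_compl, hSF'])
  exfalso
  have hp1 : 0 < S.card := Finset.card_pos.2 ⟨a, ha⟩
  have hp2 : 0 < Sᶜ.card := Finset.card_pos.2 ⟨b, Finset.mem_compl.2 hb⟩
  have key2 : ∀ T : Finset V, G.IsOuterDominated T → 2 ≤ T.card → 2 ≤ Tᶜ.card →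
      G.cutEdges T = F → False := by
    intro T hT hT1 hT2 hTF
    obtain ⟨z, hz, w, hw, hzw⟩ := Finset.one_lt_card.1 hT2
    rcases hT.isExceptional hG hc (by rw [hTF, hcard]) hT1 (Finset.mem_compl.1 hz)
      (Finset.mem_compl.1 hw) hzw with h | h
    exacts [h4 h, hj h]
  rcases hd.isOuterDominated_or S with h | h
  · exact key2 S h (by omega) (by omega) hSF'
  · exact key2 Sᶜ h (by omega) (by rw [compl_compl]; omega) (by rw [cutEdges_compl, hSF'])

theorem HasDiamLeTwo.not_isSuperEdgeConnected_of_iso (hd : G.HasDiamLeTwo)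
    (f : G ≃g cycleGraph 4) : ¬ G.IsSuperEdgeConnected := by
  classical
  have hdeg : G.minDegree = 2 := by rw [f.minDegree_eq]; decide
  have hmem : ∀ v, v ∈ ({f.symm 0, f.symm 1} : Finset V) ↔ f v = 0 ∨ f v = 1 := by
    intro v
    simp [← f.symm_apply_eq, eq_comm]
  -- Two adjacent vertices of `C₄` are separated from the other two by two edges.
  refine hd.not_isSuperEdgeConnected (S := {f.symm 0, f.symm 1})
    ⟨f.symm 0, by simp, f.symm 1, by simp, by simp⟩
    ⟨f.symm 2, ?_, f.symm 3, ?_, by simp⟩ ?_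
  · simp
  · simp
  · rw [hdeg]
    refine (Finset.card_le_card
      (t := {s(f.symm 0, f.symm 3), s(f.symm 1, f.symm 2)}) fun e he => ?_).trans
      Finset.card_le_two
    obtain ⟨v, w, hv, hw, hvw, rfl⟩ := mem_cutEdges.1 he
    obtain ⟨i, rfl⟩ := f.symm.surjective v
    obtain ⟨j, rfl⟩ := f.symm.surjective w
    rw [f.symm.map_adj_iff] at hvw
    simp only [hmem, RelIso.apply_symm_apply] at hv hw
    have : (i = 0 ∧ j = 3) ∨ (i = 1 ∧ j = 2) := by
      clear he
      revert i j
      decide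
    rcases this with ⟨rfl, rfl⟩ | ⟨rfl, rfl⟩ <;> simp

/-- Only the edges to the apex `c` leave the component `C`, so its cut has at most `|C| = δ` edges.
Since `δ(H) ≥ 1`, `C` has two vertices; `c` and a vertex of another component lie outside. -/
theorem IsExceptionalJoin.not_isSuperEdgeConnected (hd : G.HasDiamLeTwo)
    (h : G.IsExceptionalJoin) : ¬ G.IsSuperEdgeConnected := by
  classical
  obtain ⟨W, _, H, _, -, hnc, -, hdeg, ⟨C, ⟨e⟩⟩, ⟨f⟩⟩ := h
  set c := f.symm (Sum.inr 0) with hc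
  let S : Finset V := (Finset.univ.filter fun a => a ∈ C.supp).image fun a => f.symm (Sum.inl a)
  have hS : ∀ a, f.symm (Sum.inl a) ∈ S ↔ a ∈ C.supp := by
    intro a
    simp [S]
  have hcS : c ∉ S := by simp [S, hc]
  have hcardS : S.card = G.minDegree := by
    rw [Finset.card_image_of_injective _ (fun a b hab => by simpa using hab),
      ← Fintype.card_subtype, ← Nat.card_eq_fintype_card]
    exact (Nat.card_congr e.toEquiv).trans (Nat.card_fin _)
  obtain ⟨a, ha⟩ := C.nonempty_supp
  obtain ⟨b, hab⟩ := (H.degree_pos_iff_exists_adj a).1 (hdeg.trans (H.minDegree_le_degree a))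
  have hclosed : ∀ x y, x ∈ C.supp → H.Adj x y → y ∈ C.supp := fun x y hx hxy =>
    (C.mem_supp_congr_adj hxy).1 hx
  have hout : ∃ d, d ∉ C.supp := by
    by_contra! hall
    refine hnc ((connected_iff _).2 ⟨fun x y => ?_, ⟨a⟩⟩)
    exact ConnectedComponent.exact ((hall x).trans (hall y).symm)
  obtain ⟨d, hdC⟩ := hout
  refine hd.not_isSuperEdgeConnected (S := S)
    ⟨_, (hS a).2 ha, _, (hS b).2 (hclosed a b ha hab), by simpa using hab.ne⟩
    ⟨c, hcS, f.symm (Sum.inl d), (hS d).not.2 hdC, by simp [hc]⟩ ?_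
  rw [← hcardS]
  refine (Finset.card_le_card (t := S.image fun v => s(v, c)) fun e he => ?_).trans
    Finset.card_image_le
  obtain ⟨v, w, hv, hw, hvw, rfl⟩ := mem_cutEdges.1 he
  refine Finset.mem_image.2 ⟨v, hv, ?_⟩
  congr 2
  obtain ⟨x, -, rfl⟩ := Finset.mem_image.1 hv
  obtain ⟨y | i, rfl⟩ := f.symm.surjective w
  · exact absurd ((hS y).2 (hclosed x y ((hS x).1 hv)
      (joinGraph_adj_inl.1 (f.symm.map_adj_iff.1 hvw)))) hw
  · rw [hc, Subsingleton.elim i 0]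

end Main

end SimpleGraph

theorem mainTheorem6 {V : Type u} [Fintype V] (G : SimpleGraph V) [DecidableRel G.Adj]
    (hG : G.IsCograph) (hconn : G.Connected) :
    G.IsMaximallyEdgeConnected ∧
    (G.IsSuperEdgeConnected ↔
      (¬ Nonempty (G ≃g SimpleGraph.cycleGraph 4)) ∧
      (¬ ∃ (W : Type u) (_ : Fintype W) (H : SimpleGraph W) (_ : DecidableRel H.Adj),
          H.IsCograph ∧ ¬ H.Connected ∧ 4 ≤ Fintype.card W ∧ 1 ≤ H.minDegree ∧
          (∃ C : H.ConnectedComponent,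
            Nonempty (C.toSimpleGraph ≃g (⊤ : SimpleGraph (Fin G.minDegree)))) ∧
          Nonempty (G ≃g SimpleGraph.joinGraph H (⊤ : SimpleGraph (Fin 1))))) := by
  have := hconn.nonempty
  have hd := hG.hasDiamLeTwo hconn
  refine ⟨hd.edgeConnectivity_eq, fun hs => ⟨?_, fun hj => ?_⟩, fun h => ?_⟩
  · rintro ⟨f⟩
    exact hd.not_isSuperEdgeConnected_of_iso f hs
  · exact SimpleGraph.IsExceptionalJoin.not_isSuperEdgeConnected hd hj hs
  · exact hG.isSuperEdgeConnected hconn h.1 h.2
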